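/- Let $\Gamma$ be a finite group, let $n\ge 0$, let $G_n=\Gamma^n\rtimes S_n$ be the wreath product, with $S_n$ permuting the factors of $\Gamma^n$, and let $K_n=\Delta_n\times S_n\subseteq G_n$, where $\Delta_n\subseteq\Gamma^n$ is the diagonal subgroup. For a finite group $G$, a subgroup $K$ is said to form a Gelfand pair $(G,K)$ if the algebra of $K$-biinvariant functions $G\to\mathbb C$ is commutative under the convolution $(f\star g)(x)=\frac1{|G|}\sum_{y\in G}f(xy^{-1})g(y)$. Let $\{\pi_\ell\}_{\ell\in S}$ be pairwise non-isomorphic irreducible finite-dimensional complex representations of $\Gamma$, with $\pi_\ell$ acting on $V_\ell$. Let $\ell_1,\dots,\ell_n\in S$ (repetitions allowed), let $\pi=\pi_{\ell_1}\hat\otimes\cdots\hat\otimes\pi_{\ell_n}$ be the exterior tensor product, a representation of $\Gamma^n$ on $V_{\ell_1}\otimes\cdots\otimes V_{\ell_n}$, and let $S_\pi$ be the stabilizer of $\pi$ in $S_n$, that is, the group of all $\sigma\in S_n$ with $\ell_{\sigma^{-1}(i)}=\ell_i$ for all $i$. Let $\omega(\sigma)(v_1\otimes\cdots\otimes v_n)=v_{\sigma^{-1}(1)}\otimes\cdots\otimes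 v_{\sigma^{-1}(n)}$ for $\sigma\in S_\pi$, let $\pi\circ\omega$ be the representation $(\gamma,\sigma)\mapsto\pi(\gamma)\,\omega(\sigma)$ of $\Gamma^n\rtimes S_\pi$, and put $$M_\pi(\sigma)=\frac1{|\Delta_n|}\sum_{\delta\in\Delta_n}\chi_{\pi\circ\omega}(\delta,\sigma)\qquad(\sigma\in S_\pi).$$ Let $\widehat S_\pi$ be the set of isomorphism classes of irreducible complex representations of $S_\pi$. Suppose that $$M_\pi(e)>\sum_{\rho\in\widehat S_\pi}\dim\rho .$$ (Here $M_\pi(e)$ is a real number.) Then $M_\pi=\sum_{\rho\in\widehat S_\pi}a_\rho\chi_\rho$ for a unique family of complex coefficients $a_\rho$, these are nonnegative integers, and $a_\rho\ge 2$ for at least one $\rho\in\widehat S_\pi$. Moreover, $(G_n,K_n)$ is not a Gelfand pair. -/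

import Mathlib

open scoped TensorProduct

noncomputable section

namespace WreathGelfand

/-! ### Gelfand pairs -/

section Gelfand

variable {G : Type*} [Group G] [Finite G]

/-- The convolution `(f ⋆ g)(x) = |G|⁻¹ ∑_y f (x y⁻¹) g y` on complex functions on a finite group. -/
def convolution (f g : G → ℂ) : G → ℂ := fun x =>
  (Nat.card G : ℂ)⁻¹ * ∑ᶠ y : G, f (x * y⁻¹) * g y

/-- `f` is `K`-biinvariant. -/
def IsBiinvariant (K : Subgroup G) (f : G → ℂ) : Prop :=
  ∀ k₁ ∈ K, ∀ k₂ ∈ K, ∀ x : G, f (k₁ * x * k₂) = f x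

/-- `(G, K)` is a Gelfand pair: the convolution algebra of `K`-biinvariant complex functions
on `G` is commutative. -/
def IsGelfandPair (K : Subgroup G) : Prop :=
  ∀ f g : G → ℂ, IsBiinvariant K f → IsBiinvariant K g → convolution f g = convolution g f

end Gelfand

/-! ### The irreducible complex representations of a finite group, up to isomorphism -/

section Irreps

/-- Irreducible finite-dimensional complex representations of `H`, on the spaces `ℂ^d`. -/
structure Irrep (H : Type*) [Group H] where
  /-- the dimension -/
  dim : ℕ
  /-- the representation -/
  rep : Representation ℂ H (Fin dim → ℂ)
  irreducible : rep.IsIrreducible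

variable (H : Type*) [Group H]

/-- Isomorphism of irreducible representations. -/
instance irrepSetoid : Setoid (Irrep H) where
  r ρ σ := Nonempty (ρ.rep.Equiv σ.rep)
  iseqv := ⟨fun ρ => ⟨Representation.Equiv.refl ρ.rep⟩, fun ⟨e⟩ => ⟨e.symm⟩,
    fun ⟨e⟩ ⟨f⟩ => ⟨e.trans f⟩⟩

/-- `Ĥ`, the set of isomorphism classes of irreducible complex representations of `H`. -/
def Dual : Type _ := Quotient (irrepSetoid H)

variable {H}

/-- The dimension of (any representative of) a class. -/
def Dual.dim (ρ : Dual H) : ℕ :=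
  Quotient.lift (s := irrepSetoid H) (fun ρ => ρ.dim)
    (fun _ _ h => h.elim fun e => by simpa using e.toLinearEquiv.finrank_eq) ρ

/-- The character of (any representative of) a class. -/
def Dual.character (ρ : Dual H) : H → ℂ :=
  Quotient.lift (s := irrepSetoid H) (fun ρ => ρ.rep.character)
    (fun _ _ h => h.elim fun e => Representation.char_iso e) ρ

/-- The irreducible characters of a finite group are linearly independent. -/
theorem Dual.linearIndependent_character [Finite H] :
    LinearIndependent ℂ (Dual.character : Dual H → H → ℂ) := by
  classical
  have := Fintype.ofFinite H
  have : Invertible (Nat.card H : ℂ) := invertibleOfNonzero (by simp)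
  have key : ∀ ρ σ : Dual H,
      (Nat.card H : ℂ)⁻¹ * ∑ h : H, ρ.character h * σ.character h⁻¹ = if ρ = σ then 1 else 0 := by
    intro ρ σ
    induction ρ using Quotient.inductionOn with | _ ρ
    induction σ using Quotient.inductionOn with | _ σ
    have := ρ.irreducible
    have := σ.irreducible
    refine (Representation.char_orthonormal ρ.rep σ.rep).trans ?_
    have h : ((⟦ρ⟧ : Quotient (irrepSetoid H)) = ⟦σ⟧) ↔ Nonempty (σ.rep.Equiv ρ.rep) :=
      Quotient.eq.trans ⟨fun ⟨e⟩ => ⟨e.symm⟩, fun ⟨e⟩ => ⟨e.symm⟩⟩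
    exact if_congr h.symm rfl rfl
  rw [linearIndependent_iff']
  intro s c hc σ hσ
  have h0 : (Nat.card H : ℂ)⁻¹ *
      ∑ h : H, (∑ ρ ∈ s, c ρ • ρ.character) h * σ.character h⁻¹ = 0 := by
    rw [hc]; simp
  have h1 : (Nat.card H : ℂ)⁻¹ *
      ∑ h : H, (∑ ρ ∈ s, c ρ • ρ.character) h * σ.character h⁻¹ =
      ∑ ρ ∈ s, c ρ * ((Nat.card H : ℂ)⁻¹ * ∑ h : H, ρ.character h * σ.character h⁻¹) := by
    simp only [Finset.sum_apply, Pi.smul_apply, smul_eq_mul, Finset.sum_mul, Finset.mul_sum]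
    rw [Finset.sum_comm]
    refine Finset.sum_congr rfl fun ρ _ => Finset.sum_congr rfl fun h _ => by ring
  rw [h1] at h0
  simp only [key] at h0
  simpa [hσ] using h0

instance Dual.instFinite [Finite H] : Finite (Dual H) :=
  (Dual.linearIndependent_character (H := H)).finite

instance Dual.instFintype [Finite H] : Fintype (Dual H) := Fintype.ofFinite _

end Irreps

/-! ### The wreath product `G_n = Γⁿ ⋊ S_n` and its subgroup `K_n = Δ_n × S_n` -/

section Wreath

variable (Γ : Type*) [Group Γ] (n : ℕ)

/-- `G_n = Γⁿ ⋊ S_n`, where `(σ • γ) i = γ (σ⁻¹ i)`. -/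
abbrev Wreath : Type _ := (Fin n → Γ) ⋊[mulAutArrow] Equiv.Perm (Fin n)

instance [Finite Γ] : Finite (Wreath Γ n) := Finite.of_equiv _ SemidirectProduct.equivProd.symm

/-- The diagonal subgroup `Δ_n` of `Γⁿ`. -/
def diagonal : Subgroup (Fin n → Γ) where
  carrier := {γ | ∃ δ : Γ, γ = fun _ => δ}
  mul_mem' := by rintro _ _ ⟨a, rfl⟩ ⟨b, rfl⟩; exact ⟨a * b, rfl⟩
  one_mem' := ⟨1, rfl⟩
  inv_mem' := by rintro _ ⟨a, rfl⟩; exact ⟨a⁻¹, rfl⟩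

/-- `K_n = Δ_n × S_n`, the subgroup of all `(δ, σ)` in `G_n` with `δ ∈ Δ_n`. -/
def wreathK : Subgroup (Wreath Γ n) where
  carrier := {g | g.left ∈ diagonal Γ n}
  mul_mem' := by
    rintro a b ⟨x, hx⟩ ⟨y, hy⟩
    exact ⟨x * y, by rw [SemidirectProduct.mul_left, hx, hy]; rfl⟩
  one_mem' := ⟨1, rfl⟩
  inv_mem' := by
    rintro a ⟨x, hx⟩
    exact ⟨x⁻¹, by rw [SemidirectProduct.inv_left, hx]; rfl⟩

end Wreath

/-! ### The representation `π ∘ ω` and the class function `M_π` -/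

section Mpi

variable {Γ : Type*} [Group Γ] {S : Type*} {V : S → Type*} [∀ s, AddCommGroup (V s)]
  [∀ s, Module ℂ (V s)] {n : ℕ}

/-- `S_π`: the permutations that fix the tuple `(ℓ₁, …, ℓ_n)` of labels of the irreducible factors
of `π = π_{ℓ₁} ⊗ ⋯ ⊗ π_{ℓ_n}`, where distinct labels stand for non-isomorphic representations. -/
def stab (l : Fin n → S) : Subgroup (Equiv.Perm (Fin n)) where
  carrier := {σ | ∀ i, l (σ⁻¹ i) = l i}
  mul_mem' := by
    intro a b ha hb i
    rw [mul_inv_rev, Equiv.Perm.mul_apply, hb, ha]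
  one_mem' := fun _ => rfl
  inv_mem' := by
    intro a ha i
    have h := ha (a i)
    rw [Equiv.Perm.inv_def, Equiv.symm_apply_apply] at h
    rw [inv_inv, h]

/-- The exterior tensor product `π = π_{ℓ₁} ⊗ ⋯ ⊗ π_{ℓ_n}`, a representation of `Γⁿ`. -/
def extTensor (p : ∀ s, Representation ℂ Γ (V s)) (l : Fin n → S) :
    Representation ℂ (Fin n → Γ) (⨂[ℂ] i, V (l i)) where
  toFun γ := PiTensorProduct.map fun i => p (l i) (γ i)
  map_one' := by simp
  map_mul' a b := by
    simp only [Pi.mul_apply, map_mul]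
    exact PiTensorProduct.map_mul _ _

/-- The operator `v₁ ⊗ ⋯ ⊗ v_n ↦ v_{σ⁻¹ 1} ⊗ ⋯ ⊗ v_{σ⁻¹ n}`, for `σ` in `S_π`; here the space
`V (l (σ⁻¹ i))` is the space `V (l i)`. -/
def omegaOp (V : S → Type*) [∀ s, AddCommGroup (V s)] [∀ s, Module ℂ (V s)]
    (l : Fin n → S) (σ : stab l) : (⨂[ℂ] i, V (l i)) →ₗ[ℂ] ⨂[ℂ] i, V (l i) :=
  PiTensorProduct.map
      (fun i => (LinearEquiv.cast (R := ℂ) (M := V) (σ.2 i) :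
        V (l (σ.1.symm i)) →ₗ[ℂ] V (l i))) ∘ₗ
    (PiTensorProduct.reindex ℂ (fun i => V (l i)) σ.1).toLinearMap

theorem omegaOp_tprod (l : Fin n → S) (σ : stab l) (v : ∀ i, V (l i)) :
    omegaOp V l σ (PiTensorProduct.tprod ℂ v) =
      PiTensorProduct.tprod ℂ fun i => cast (congrArg V (σ.2 i)) (v (σ.1⁻¹ i)) := by
  simp only [omegaOp, LinearMap.comp_apply, LinearEquiv.coe_coe]
  rw [PiTensorProduct.reindex_tprod, PiTensorProduct.map_tprod]
  rfl

theorem cast_rep (p : ∀ s, Representation ℂ Γ (V s)) {s t : S} (h : s = t) (g : Γ) (x : V s) :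
    cast (congrArg V h) (p s g x) = p t g (cast (congrArg V h) x) := by
  subst h; rfl

/-- The intertwining representation `ω` of `S_π`. -/
def omega (V : S → Type*) [∀ s, AddCommGroup (V s)] [∀ s, Module ℂ (V s)] (l : Fin n → S) :
    Representation ℂ (stab l) (⨂[ℂ] i, V (l i)) where
  toFun := omegaOp V l
  map_one' := by
    refine PiTensorProduct.ext (MultilinearMap.ext fun v => ?_)
    simp only [LinearMap.compMultilinearMap_apply, omegaOp_tprod]
    rfl
  map_mul' a b := by
    refine PiTensorProduct.ext (MultilinearMap.ext fun v => ?_)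
    simp only [LinearMap.compMultilinearMap_apply, Module.End.mul_apply, omegaOp_tprod, cast_cast]
    congr 1

theorem omega_extTensor (p : ∀ s, Representation ℂ Γ (V s)) (l : Fin n → S) (σ : stab l)
    (γ : Fin n → Γ) :
    omega V l σ * extTensor p l γ = extTensor p l (mulAutArrow σ γ) * omega V l σ := by
  refine PiTensorProduct.ext (MultilinearMap.ext fun v => ?_)
  simp only [LinearMap.compMultilinearMap_apply, Module.End.mul_apply, omega, extTensor,
    MonoidHom.coe_mk, OneHom.coe_mk, omegaOp_tprod, PiTensorProduct.map_tprod]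
  congr 1
  funext i
  exact cast_rep p (σ.2 i) _ _

/-- The representation `π ∘ ω` of `Γⁿ ⋊ S_π`, `(γ, σ) ↦ π γ ∘ ω σ`. -/
def piOmega (p : ∀ s, Representation ℂ Γ (V s)) (l : Fin n → S) :
    Representation ℂ ((Fin n → Γ) ⋊[mulAutArrow] (stab l)) (⨂[ℂ] i, V (l i)) where
  toFun g := extTensor p l g.left * omega V l g.right
  map_one' := by simp
  map_mul' a b := by
    simp only [SemidirectProduct.mul_left, SemidirectProduct.mul_right, map_mul]
    rw [mul_assoc, mul_assoc, ← mul_assoc (omega V l a.right), omega_extTensor, mul_assoc]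

/-- `M_π(σ) = |Δ_n|⁻¹ ∑_{δ ∈ Δ_n} χ_{π ∘ ω}(δ, σ)`. -/
def Mpi (p : ∀ s, Representation ℂ Γ (V s)) (l : Fin n → S) (σ : stab l) : ℂ :=
  (Nat.card (diagonal Γ n) : ℂ)⁻¹ * ∑ᶠ δ : diagonal Γ n, (piOmega p l).character ⟨δ, σ⟩

end Mpi

end WreathGelfand

end

open scoped TensorProduct

noncomputable section

namespace WreathGelfand

/-! ### Multiplicities and the endomorphism algebra -/

section Decomposition

open scoped MonoidAlgebra
open Representation

variable {H : Type*} [Group H]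

/-! Let `W` be the space of `π` and `W^Δ` its diagonal invariants. Since `ω` commutes with the
diagonal, `S_π` acts on `W^Δ`, and `M_π` is the character of this action (`Mpi_eq_character`). So
its coefficients are multiplicities and `M_π(e) = ∑ a_ρ dim ρ`; the hypothesis forces some `a_ρ ≥
2`, which makes the commutant of `S_π` on `W^Δ` noncommutative (`exists_multiplicity`).

A Gelfand pair would make this commutant commutative (`intertwiningMap_comm_of_isGelfandPair`). An
endomorphism `A` of `W^Δ` commuting with `S_π` extends, through the averaging projection onto `W^Δ`,
to an operator on `W` that commutes with `ω` and absorbs the diagonal on both sides. By Schur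
orthogonality every operator on `W` is an integral of `π` against a function; averaging that
function over `S_n` and over the diagonal on both sides makes it symmetric and biinvariant without
changing the operator, up to a known scalar. Such functions pull back to `K_n`-biinvariant functions
on `G_n`, and their convolutions become products of operators. -/

theorem exists_irrep_linearEquiv [Finite H] (M : Type*) [AddCommGroup M] [Module ℂ[H] M]
    [IsSimpleModule ℂ[H] M] : ∃ R : Irrep H, Nonempty (M ≃ₗ[ℂ[H]] R.rep.asModule) := by
  let _ : Module ℂ M := Module.compHom M (algebraMap ℂ ℂ[H])
  have : IsScalarTower ℂ ℂ[H] M := IsScalarTower.of_algebraMap_smul fun _ _ => rfl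
  have : Module.Finite ℂ M := Module.Finite.trans ℂ[H] _
  let e := (Module.finBasis ℂ M).equivFun
  let ρ : Representation ℂ H (Fin (Module.finrank ℂ M) → ℂ) :=
    (e.conjAlgEquiv ℂ).toAlgHom.toRingHom.toMonoidHom.comp (ofModule' M)
  have key : ∀ (r : ℂ[H]) (m : M), e (r • m) = ρ.asAlgebraHom r (e m) := by
    intro r m
    induction r using MonoidAlgebra.induction_linear with
    | zero => simp
    | add x y hx hy => simp [add_smul, hx, hy]
    | single g a =>
      rw [asAlgebraHom_single, LinearMap.smul_apply]
      have h : MonoidAlgebra.single g a • m = a • (MonoidAlgebra.single g (1 : ℂ) • m) := by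
        rw [← smul_assoc]; simp
      rw [h, map_smul]
      simp [ρ, ofModule', LinearEquiv.conjAlgEquiv_apply]
  let f : M ≃ₗ[ℂ[H]] ρ.asModule :=
    { toAddEquiv := e.toAddEquiv.trans ρ.asModuleEquiv.symm.toAddEquiv
      map_smul' := fun r m => key r m }
  exact ⟨⟨_, ρ, (irreducible_iff_isSimpleModule_asModule ρ).2 (IsSimpleModule.congr f.symm)⟩, ⟨f⟩⟩

/-- Maschke's theorem, with explicit inclusions and projections so that traces can be split and
matrix units between summands written down. -/
theorem exists_irrep_decomposition [Finite H] {W : Type*} [AddCommGroup W] [Module ℂ W]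
    [FiniteDimensional ℂ W] (τ : Representation ℂ H W) :
    ∃ (m : ℕ) (R : Fin m → Irrep H) (i : ∀ j, IntertwiningMap (R j).rep τ)
      (q : ∀ j, IntertwiningMap τ (R j).rep), (∀ j v, q j (i j v) = v) ∧
      (∀ j k, j ≠ k → ∀ v, q j (i k v) = 0) ∧ ∀ w, ∑ j, i j (q j w) = w := by
  have : NeZero (Nat.card H : ℂ) := ⟨Nat.cast_ne_zero.2 Nat.card_pos.ne'⟩
  have : Module.Finite ℂ[H] τ.asModule := Module.Finite.of_restrictScalars_finite ℂ _ _
  obtain ⟨m, S, e, hS⟩ := IsSemisimpleModule.exists_linearEquiv_fin_dfinsupp ℂ[H] τ.asModule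
  choose R f using fun j => exists_irrep_linearEquiv (H := H) (S j)
  let f := fun j => (f j).some
  refine ⟨m, R, fun j => (IntertwiningMap.equivLinearMapAsModule _ _).symm
    (e.symm.toLinearMap ∘ₗ DFinsupp.lsingle j ∘ₗ (f j).symm.toLinearMap),
    fun j => (IntertwiningMap.equivLinearMapAsModule _ _).symm
    ((f j).toLinearMap ∘ₗ DFinsupp.lapply j ∘ₗ e.toLinearMap), ?_, ?_, ?_⟩
  · intro j v
    change f j (e (e.symm (DFinsupp.single j ((f j).symm v))) j) = v
    rw [LinearEquiv.apply_symm_apply, DFinsupp.single_eq_same]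
    exact LinearEquiv.apply_symm_apply (f j) v
  · intro j k hjk v
    change f j (e (e.symm (DFinsupp.single k ((f k).symm v))) j) = 0
    rw [LinearEquiv.apply_symm_apply, DFinsupp.single_eq_of_ne hjk, map_zero]
  · intro w
    have h : ∀ x : τ.asModule,
        ∑ j, e.symm (DFinsupp.single j ((f j).symm (f j (e x j)))) = x := by
      intro x
      simp only [LinearEquiv.symm_apply_apply, ← map_sum]
      rw [LinearEquiv.symm_apply_eq]
      ext k
      simp [DFinsupp.single_apply]
    exact h w

theorem Dual.character_one (ρ : Dual H) : ρ.character 1 = ρ.dim := by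
  induction ρ using Quotient.inductionOn with | _ ρ
  exact (Representation.char_one ρ.rep).trans (congrArg _ (Module.finrank_fin_fun ℂ))

/-- A representation of a finite group has multiplicities; if one of them is at least two, then
its endomorphism algebra is not commutative. -/
theorem exists_multiplicity [Finite H] {W : Type*} [AddCommGroup W] [Module ℂ W]
    [FiniteDimensional ℂ W] (τ : Representation ℂ H W) :
    ∃ a : Dual H → ℕ, (∀ h, τ.character h = ∑ ρ, (a ρ : ℂ) * ρ.character h) ∧
      ∀ ρ, 2 ≤ a ρ → ∃ A B : IntertwiningMap τ τ, A.comp B ≠ B.comp A := by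
  classical
  obtain ⟨m, R, i, q, hqi, hqi0, hsum⟩ := exists_irrep_decomposition τ
  let cl : Fin m → Dual H := fun j => Quotient.mk (irrepSetoid H) (R j)
  refine ⟨fun ρ => (Finset.univ.filter fun j => cl j = ρ).card, fun h => ?_, fun ρ hρ => ?_⟩
  · have h1 : τ h = ∑ j, (i j).toLinearMap ∘ₗ ((q j).toLinearMap ∘ₗ τ h) := by
      ext w
      simpa [LinearMap.sum_apply] using (hsum (τ h w)).symm
    have h2 : τ.character h = ∑ j, (cl j).character h := by
      rw [Representation.character, h1, map_sum]
      refine Finset.sum_congr rfl fun j _ => ?_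
      -- By cyclicity the summand has the trace of `q j ∘ τ h ∘ i j`, which is `(R j).rep h`.
      rw [LinearMap.trace_comp_comm']
      change _ = LinearMap.trace ℂ _ ((R j).rep h)
      congr 1
      ext1 v
      ext1
      simp [IntertwiningMap.isIntertwining, hqi]
    rw [h2, ← Finset.sum_fiberwise_of_maps_to (s := Finset.univ) (t := Finset.univ) (g := cl)
      (fun _ _ => Finset.mem_univ _)]
    refine Finset.sum_congr rfl fun ρ _ => ?_
    rw [Finset.sum_congr rfl (g := fun _ => ρ.character h)
      (fun j hj => by rw [(Finset.mem_filter.1 hj).2])]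
    simp
  · obtain ⟨j, hj, k, hk, hjk⟩ := Finset.one_lt_card.1 hρ
    obtain ⟨e⟩ : Nonempty ((R k).rep.Equiv (R j).rep) :=
      Quotient.exact ((Finset.mem_filter.1 hk).2.trans (Finset.mem_filter.1 hj).2.symm)
    -- These are the matrix units `E_jj` and `E_jk` of two isomorphic summands: `E_jj E_jk = E_jk`,
    -- whereas `E_jk E_jj = 0`.
    refine ⟨(i j).comp (q j), (i j).comp (e.toIntertwiningMap.comp (q k)), fun hAB => ?_⟩
    have := (R k).irreducible
    have hnt : ∃ v : Fin (R k).dim → ℂ, v ≠ 0 := by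
      by_contra! hv
      refine bot_ne_top (α := Subrepresentation (R k).rep) ?_
      ext v
      simp [hv v]
    obtain ⟨v, hv⟩ := hnt
    have h := congrArg (fun A => q j (A (i k v))) hAB
    simp only [IntertwiningMap.comp_apply, hqi, hqi0 j k hjk, map_zero] at h
    exact hv (e.toLinearEquiv.injective (h.trans (map_zero _).symm))

end Decomposition

/-! ### Schur orthogonality as a statement about operators -/

section Schur

open Representation

variable {Γ : Type*} [Group Γ] [Fintype Γ] {V W : Type*} [AddCommGroup V] [Module ℂ V]
  [AddCommGroup W] [Module ℂ W]

/-- The operator `∑ g, f g • ρ g`. -/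
def integrate (ρ : Representation ℂ Γ V) (f : Γ → ℂ) : V →ₗ[ℂ] V := ∑ g, f g • ρ g

/-- The sum of the conjugates of a linear map over the group, an intertwining map. -/
def conjSum (ρ : Representation ℂ Γ V) (σ : Representation ℂ Γ W) (A : V →ₗ[ℂ] W) :
    IntertwiningMap ρ σ where
  toLinearMap := ∑ g, σ g ∘ₗ A ∘ₗ ρ g⁻¹
  isIntertwining' h := by
    ext v
    simp only [LinearMap.comp_apply, LinearMap.sum_apply, map_sum]
    refine Fintype.sum_equiv (Equiv.mulLeft h⁻¹) _ _ fun g => ?_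
    simp [← Module.End.mul_apply, ← map_mul]

theorem conjSum_apply (ρ : Representation ℂ Γ V) (σ : Representation ℂ Γ W) (A : V →ₗ[ℂ] W)
    (v : V) : conjSum ρ σ A v = ∑ g, σ g (A (ρ g⁻¹ v)) := by
  change (∑ g, σ g ∘ₗ A ∘ₗ ρ g⁻¹) v = _
  simp

/-- By Schur's lemma the sum is a scalar, which its trace determines; multiplying by the dimension
avoids a division. -/
theorem finrank_smul_conjSum [FiniteDimensional ℂ V] (ρ : Representation ℂ Γ V)
    [hρ : ρ.IsIrreducible] (A : V →ₗ[ℂ] V) (v : V) :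
    (Module.finrank ℂ V : ℂ) • conjSum ρ ρ A v =
      (Fintype.card Γ * LinearMap.trace ℂ V A : ℂ) • v := by
  obtain ⟨c, hc⟩ :=
    (IsIrreducible.algebraMap_intertwiningMap_bijective_of_isAlgClosed (ρ := ρ)).2 (conjSum ρ ρ A)
  have hc' : (conjSum ρ ρ A).toLinearMap = c • LinearMap.id := by
    rw [← hc]; rfl
  have htr : LinearMap.trace ℂ V (conjSum ρ ρ A).toLinearMap =
      Fintype.card Γ * LinearMap.trace ℂ V A := by
    change LinearMap.trace ℂ V (∑ g, ρ g ∘ₗ A ∘ₗ ρ g⁻¹) = _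
    rw [map_sum, Finset.sum_congr rfl (g := fun _ => LinearMap.trace ℂ V A)]
    · simp
    · intro g _
      rw [LinearMap.trace_comp_comm', LinearMap.comp_assoc]
      change LinearMap.trace ℂ V (A * (ρ g⁻¹ * ρ g)) = _
      rw [← map_mul]; simp
  rw [hc', map_smul, LinearMap.trace_id] at htr
  rw [← htr, ← IntertwiningMap.toLinearMap_apply, hc', LinearMap.smul_apply, smul_smul]
  simp [mul_comm]

/-- Matrix coefficients of an irreducible representation integrate to rank one operators on it and
to zero on non-isomorphic irreducible representations. -/
theorem exists_integrate_eq_smulRight {S : Type*} {V : S → Type*} [∀ s, AddCommGroup (V s)]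
    [∀ s, Module ℂ (V s)] [∀ s, FiniteDimensional ℂ (V s)]
    (p : ∀ s, Representation ℂ Γ (V s)) (hirr : ∀ s, (p s).IsIrreducible)
    (hne : ∀ s t, Nonempty ((p s).Equiv (p t)) → s = t) (s : S) (φ : V s →ₗ[ℂ] ℂ) (u : V s) :
    ∃ x : Γ → ℂ, integrate (p s) x = φ.smulRight u ∧ ∀ t, t ≠ s → integrate (p t) x = 0 := by
  have := hirr s
  by_cases hd : (Module.finrank ℂ (V s) : ℂ) = 0
  · have : Subsingleton (V s) := Module.finrank_zero_iff.1 (by exact_mod_cast hd)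
    exact ⟨0, Subsingleton.elim _ _, fun t _ => by simp [integrate]⟩
  have hc : (Fintype.card Γ : ℂ) ≠ 0 := Nat.cast_ne_zero.2 Fintype.card_ne_zero
  -- The integral of this matrix coefficient, applied to `v`, is a multiple of the conjugate sum of
  -- the rank one map `φ ⊗ v`, evaluated at `u`. For `t = s` its trace `φ v` appears; for `t ≠ s`
  -- Schur's lemma makes it zero.
  have key : ∀ t (v : V t), integrate (p t) (fun g => (Fintype.card Γ : ℂ)⁻¹ *
      Module.finrank ℂ (V s) * φ (p s g⁻¹ u)) v = ((Fintype.card Γ : ℂ)⁻¹ *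
      Module.finrank ℂ (V s)) • conjSum (p s) (p t) (φ.smulRight v) u := by
    intro t v
    simp [integrate, conjSum_apply, Finset.smul_sum, smul_smul]
  refine ⟨fun g => (Fintype.card Γ : ℂ)⁻¹ * Module.finrank ℂ (V s) * φ (p s g⁻¹ u), ?_, ?_⟩
  · ext v
    rw [key, mul_smul, finrank_smul_conjSum, smul_smul, inv_mul_cancel_left₀ hc,
      LinearMap.trace_smulRight]
    rfl
  · intro t ht
    have := hirr t
    have : IsEmpty ((p s).Equiv (p t)) := ⟨fun e => ht (hne s t ⟨e⟩).symm⟩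
    ext v
    rw [key, Subsingleton.elim (conjSum (p s) (p t) (φ.smulRight v)) 0]
    simp

end Schur

/-! ### Operators on the exterior tensor product -/

section Tensor

variable {Γ : Type*} [Group Γ] [Fintype Γ] {S : Type*} {V : S → Type*} [∀ s, AddCommGroup (V s)]
  [∀ s, Module ℂ (V s)] {n : ℕ}

theorem integrate_extTensor_prod (p : ∀ s, Representation ℂ Γ (V s)) (l : Fin n → S)
    (x : Fin n → Γ → ℂ) :
    integrate (extTensor p l) (fun γ => ∏ i, x i (γ i)) =
      PiTensorProduct.map fun i => integrate (p (l i)) (x i) := by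
  have h := (PiTensorProduct.mapMultilinear ℂ (fun i => V (l i)) (fun i => V (l i))).map_sum
    (fun i (g : Γ) => x i g • p (l i) g)
  simp only [PiTensorProduct.mapMultilinear_apply] at h
  refine Eq.trans ?_ h.symm
  refine Finset.sum_congr rfl fun γ _ => ?_
  exact ((PiTensorProduct.mapMultilinear ℂ (fun i => V (l i)) (fun i => V (l i))).map_smul_univ
    (fun i => x i (γ i)) (fun i => p (l i) (γ i))).symm

/-- By linearity `T` may be a matrix unit, a tensor product of rank one operators, each the integral
of a function that integrates to zero on every other label. A permutation outside `S_π` moves some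
function to a factor with another label, which kills the whole tensor product. -/
theorem exists_integrate_extTensor_eq [∀ s, FiniteDimensional ℂ (V s)]
    (p : ∀ s, Representation ℂ Γ (V s)) (hirr : ∀ s, (p s).IsIrreducible)
    (hne : ∀ s t, Nonempty ((p s).Equiv (p t)) → s = t) (l : Fin n → S)
    (T : (⨂[ℂ] i, V (l i)) →ₗ[ℂ] ⨂[ℂ] i, V (l i)) :
    ∃ f : (Fin n → Γ) → ℂ, integrate (extTensor p l) f = T ∧ ∀ σ : Equiv.Perm (Fin n),
      σ ∉ stab l → integrate (extTensor p l) (fun γ => f (mulAutArrow σ γ)) = 0 := by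
  classical
  let b := fun i => Module.finBasis ℂ (V (l i))
  let B := Basis.piTensorProduct b
  let E := B.linearMap B
  have hT : T ∈ Submodule.span ℂ (Set.range E) := by rw [E.span_eq]; trivial
  induction hT using Submodule.span_induction with
  | zero => exact ⟨0, by simp [integrate], by simp [integrate]⟩
  | add T T' _ _ h h' =>
    obtain ⟨f, hf, hf'⟩ := h
    obtain ⟨g, hg, hg'⟩ := h'
    refine ⟨f + g, ?_, fun σ hσ => ?_⟩
    · rw [← hf, ← hg]; simp [integrate, add_smul, Finset.sum_add_distrib]
    · rw [← add_zero (0 : (⨂[ℂ] i, V (l i)) →ₗ[ℂ] _)]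
      nth_rw 1 [← hf' σ hσ]
      rw [← hg' σ hσ]; simp [integrate, add_smul, Finset.sum_add_distrib]
  | smul c T _ h =>
    obtain ⟨f, hf, hf'⟩ := h
    refine ⟨c • f, ?_, fun σ hσ => ?_⟩
    · rw [← hf]; simp [integrate, mul_smul, Finset.smul_sum]
    · rw [← smul_zero c, ← hf' σ hσ]; simp [integrate, mul_smul, Finset.smul_sum]
  | mem T hT =>
    obtain ⟨⟨r, q⟩, rfl⟩ := hT
    choose x hx hx0 using fun i => exists_integrate_eq_smulRight p hirr hne (l i)
      ((b i).coord (q i)) (b i (r i))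
    refine ⟨fun γ => ∏ i, x i (γ i), ?_, fun σ hσ => ?_⟩
    · rw [integrate_extTensor_prod]
      refine B.ext fun k => ?_
      simp only [E, Module.Basis.linearMap_apply_apply]
      simp only [B, Basis.piTensorProduct_apply, PiTensorProduct.map_tprod, hx,
        LinearMap.smulRight_apply, Module.Basis.coord_apply, Module.Basis.repr_self,
        Finsupp.single_apply]
      rw [MultilinearMap.map_smul_univ]
      by_cases hk : k = q
      · subst hk; simp
      · obtain ⟨i, hi⟩ := Function.ne_iff.1 hk
        rw [Finset.prod_eq_zero (Finset.mem_univ i) (by simp [hi]), zero_smul]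
        simp [Ne.symm hk]
    · have h : (fun γ : Fin n → Γ => ∏ i, x i (mulAutArrow σ γ i)) =
          fun γ => ∏ i, x (σ i) (γ i) := by
        funext γ
        refine Fintype.prod_equiv σ.symm _ _ fun i => ?_
        rw [Equiv.apply_symm_apply]
        rfl
      rw [h, integrate_extTensor_prod]
      obtain ⟨i, hi⟩ : ∃ i, l (σ⁻¹ i) ≠ l i := by
        by_contra! h
        exact hσ h
      -- After reindexing, the factor at `σ⁻¹ i` carries `x i`, made for the label `l i ≠ l (σ⁻¹
      -- i)`.
      refine (PiTensorProduct.mapMultilinear ℂ (fun i => V (l i))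
        (fun i => V (l i))).map_coord_zero (σ⁻¹ i) ?_
      refine hx0 _ _ ?_
      simpa using hi

end Tensor

/-! ### Symmetric biinvariant functions and the Gelfand property -/

section Biinvariant

variable {Γ : Type*} [Group Γ] {n : ℕ}

theorem mulAutArrow_of_mem_diagonal {δ : Fin n → Γ} (hδ : δ ∈ diagonal Γ n)
    (σ : Equiv.Perm (Fin n)) : mulAutArrow σ δ = δ := by
  obtain ⟨a, rfl⟩ := hδ
  rfl

variable [Fintype Γ]

theorem integrate_mul_integrate {G V : Type*} [Group G] [Fintype G] [AddCommGroup V] [Module ℂ V]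
    (ρ : Representation ℂ G V) (f g : G → ℂ) :
    integrate ρ f * integrate ρ g = integrate ρ fun x => ∑ y, f (x * y⁻¹) * g y := by
  simp only [integrate, Finset.sum_mul_sum, Finset.sum_smul]
  rw [Finset.sum_comm]
  conv_rhs => rw [Finset.sum_comm]
  refine Finset.sum_congr rfl fun y _ => ?_
  refine Fintype.sum_equiv (Equiv.mulRight y) _ _ fun x => ?_
  simp [smul_smul, mul_comm]

/-- Permutations fix the diagonal, so `(γ, σ) ↦ F γ` is biinvariant under `K_n`. Convolution of two
such functions on `G_n`, read at `(γ, 1)`, is a nonzero constant times convolution on `Γⁿ`. -/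
theorem integrate_commute_of_isGelfandPair (hG : IsGelfandPair (wreathK Γ n)) {V : Type*}
    [AddCommGroup V] [Module ℂ V] (ρ : Representation ℂ (Fin n → Γ) V) (F F' : (Fin n → Γ) → ℂ)
    (hF : IsBiinvariant (diagonal Γ n) F) (hF' : IsBiinvariant (diagonal Γ n) F')
    (hσ : ∀ (σ : Equiv.Perm (Fin n)) γ, F (mulAutArrow σ γ) = F γ)
    (hσ' : ∀ (σ : Equiv.Perm (Fin n)) γ, F' (mulAutArrow σ γ) = F' γ) :
    integrate ρ F * integrate ρ F' = integrate ρ F' * integrate ρ F := by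
  have bi : ∀ f : (Fin n → Γ) → ℂ, IsBiinvariant (diagonal Γ n) f →
      (∀ (σ : Equiv.Perm (Fin n)) γ, f (mulAutArrow σ γ) = f γ) →
      IsBiinvariant (wreathK Γ n) fun x : Wreath Γ n => f x.left := by
    intro f hf hs k₁ hk₁ k₂ hk₂ x
    simp only [SemidirectProduct.mul_left, mulAutArrow_of_mem_diagonal hk₂]
    rw [hf _ hk₁ _ hk₂, hs]
  have conv : ∀ f g : (Fin n → Γ) → ℂ, (∀ (σ : Equiv.Perm (Fin n)) γ, g (mulAutArrow σ γ) = g γ) →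
      ∀ γ, convolution (fun x : Wreath Γ n => f x.left) (fun x => g x.left) ⟨γ, 1⟩ =
        (Nat.card (Wreath Γ n) : ℂ)⁻¹ * (Fintype.card (Equiv.Perm (Fin n)) *
          ∑ η, f (γ * η⁻¹) * g η) := by
    intro f g hg γ
    rw [convolution]
    congr 1
    rw [← finsum_comp_equiv (SemidirectProduct.equivProd (φ := mulAutArrow (G := Equiv.Perm (Fin n))
      (A := Fin n) (M := Γ))).symm, finsum_eq_sum_of_fintype, Fintype.sum_prod_type_right,
      Finset.sum_congr rfl (g := fun _ => ∑ η, f (γ * η⁻¹) * g η)]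
    · simp
    · intro σ _
      -- The inverse of `(η, σ)` has left part `σ⁻¹ • η⁻¹`; substituting `σ⁻¹ • η` and using the
      -- symmetry of `g` removes `σ`.
      refine Fintype.sum_equiv (mulAutArrow σ⁻¹ : (Fin n → Γ) ≃* (Fin n → Γ)).toEquiv _ _
        fun η => ?_
      change f (γ * mulAutArrow 1 (mulAutArrow σ⁻¹ η⁻¹)) * g η =
        f (γ * (mulAutArrow σ⁻¹ η)⁻¹) * g (mulAutArrow σ⁻¹ η)
      rw [hg, map_one, map_inv]
      rfl
  rw [integrate_mul_integrate, integrate_mul_integrate]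
  congr 1
  funext γ
  have h := congrFun (hG _ _ (bi F hF hσ) (bi F' hF' hσ')) ⟨γ, 1⟩
  rw [conv F F' hσ', conv F' F hσ] at h
  exact mul_left_cancel₀ (Nat.cast_ne_zero.2 Fintype.card_ne_zero)
    (mul_left_cancel₀ (inv_ne_zero (Nat.cast_ne_zero.2 Nat.card_pos.ne')) h)

/-- An operator fixed by the diagonal on both sides that is the integral of a symmetric function
is the integral of a symmetric biinvariant function. -/
theorem exists_isBiinvariant_integrate_eq {V : Type*} [AddCommGroup V] [Module ℂ V]
    (ρ : Representation ℂ (Fin n → Γ) V) (f : (Fin n → Γ) → ℂ)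
    (hf : ∀ (σ : Equiv.Perm (Fin n)) γ, f (mulAutArrow σ γ) = f γ)
    (hl : ∀ δ ∈ diagonal Γ n, ρ δ * integrate ρ f = integrate ρ f)
    (hr : ∀ δ ∈ diagonal Γ n, integrate ρ f * ρ δ = integrate ρ f) :
    ∃ F : (Fin n → Γ) → ℂ, IsBiinvariant (diagonal Γ n) F ∧
      (∀ (σ : Equiv.Perm (Fin n)) γ, F (mulAutArrow σ γ) = F γ) ∧
      integrate ρ F = integrate ρ f := by
  classical
  have : Fintype (diagonal Γ n) := Fintype.ofFinite _
  have hc : (Fintype.card (diagonal Γ n) : ℂ) ≠ 0 := Nat.cast_ne_zero.2 Fintype.card_ne_zero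
  refine ⟨fun γ => ((Fintype.card (diagonal Γ n) : ℂ)⁻¹ * (Fintype.card (diagonal Γ n) : ℂ)⁻¹) *
    ∑ a : diagonal Γ n, ∑ b : diagonal Γ n, f (a * γ * b), ?_, ?_, ?_⟩
  · intro k₁ hk₁ k₂ hk₂ γ
    refine congrArg _ ?_
    refine Fintype.sum_equiv (Equiv.mulRight ⟨k₁, hk₁⟩) _ _ fun a => ?_
    refine Fintype.sum_equiv (Equiv.mulLeft ⟨k₂, hk₂⟩) _ _ fun b => ?_
    simp [mul_assoc]
  · intro σ γ
    refine congrArg _ ?_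
    refine Finset.sum_congr rfl fun a _ => Finset.sum_congr rfl fun b _ => ?_
    rw [← hf σ (a * γ * b), map_mul, map_mul, mulAutArrow_of_mem_diagonal a.2,
      mulAutArrow_of_mem_diagonal b.2]
  · have h : ∀ a b : diagonal Γ n, ∑ γ, f (a * γ * b) • ρ γ = integrate ρ f := by
      intro a b
      rw [← hl _ (inv_mem a.2), ← hr _ (inv_mem b.2), integrate, Finset.sum_mul, Finset.mul_sum]
      refine Fintype.sum_equiv ((Equiv.mulLeft (a : Fin n → Γ)).trans (Equiv.mulRight b)) _ _
        fun γ => ?_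
      simp only [Equiv.trans_apply, Equiv.coe_mulLeft, Equiv.coe_mulRight, smul_mul_assoc,
        mul_smul_comm, ← map_mul]
      congr 2
      group
    have h2 : ∀ γ, (((Fintype.card (diagonal Γ n) : ℂ)⁻¹ * (Fintype.card (diagonal Γ n) : ℂ)⁻¹) *
        ∑ a : diagonal Γ n, ∑ b : diagonal Γ n, f (a * γ * b)) • ρ γ =
        ((Fintype.card (diagonal Γ n) : ℂ)⁻¹ * (Fintype.card (diagonal Γ n) : ℂ)⁻¹) •
        ∑ a : diagonal Γ n, ∑ b : diagonal Γ n, f (a * γ * b) • ρ γ := by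
      intro γ
      simp only [mul_smul, Finset.sum_smul]
    rw [integrate, Finset.sum_congr rfl fun γ _ => h2 γ, ← Finset.smul_sum, Finset.sum_comm,
      Finset.sum_congr rfl fun a _ => Finset.sum_comm.trans (Finset.sum_congr rfl fun b _ => h a b)]
    simp only [Finset.sum_const, Finset.card_univ, ← Nat.cast_smul_eq_nsmul ℂ, smul_smul]
    rw [← mul_assoc, inv_mul_cancel_right₀ hc, inv_mul_cancel₀ hc, one_smul]

variable {S : Type*} {V : S → Type*} [∀ s, AddCommGroup (V s)] [∀ s, Module ℂ (V s)]

/-- Permuting the argument of `f` conjugates the operator by `ω`, so it changes nothing when the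
operator commutes with `ω`. -/
theorem integrate_comp_mulAutArrow (p : ∀ s, Representation ℂ Γ (V s)) (l : Fin n → S)
    (σ : stab l) (f : (Fin n → Γ) → ℂ) :
    integrate (extTensor p l) (fun γ => f (mulAutArrow (σ : Equiv.Perm (Fin n)) γ)) *
      omega V l σ⁻¹ = omega V l σ⁻¹ * integrate (extTensor p l) f := by
  rw [integrate, integrate, Finset.sum_mul, Finset.mul_sum]
  refine Fintype.sum_equiv
    (mulAutArrow (σ : Equiv.Perm (Fin n)) : (Fin n → Γ) ≃* (Fin n → Γ)).toEquiv _ _ fun γ => ?_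
  rw [mul_smul_comm, omega_extTensor, smul_mul_assoc]
  congr 3
  change γ = mulAutArrow (σ⁻¹ : Equiv.Perm (Fin n)) (mulAutArrow (σ : Equiv.Perm (Fin n)) γ)
  rw [map_inv]
  exact ((mulAutArrow (σ : Equiv.Perm (Fin n)) : (Fin n → Γ) ≃* (Fin n → Γ)).symm_apply_apply
    γ).symm

/-- The commutant of `ω` consists of integrals of symmetric functions. -/
theorem exists_symmetric_integrate_eq [∀ s, FiniteDimensional ℂ (V s)]
    (p : ∀ s, Representation ℂ Γ (V s)) (hirr : ∀ s, (p s).IsIrreducible)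
    (hne : ∀ s t, Nonempty ((p s).Equiv (p t)) → s = t) (l : Fin n → S)
    (T : (⨂[ℂ] i, V (l i)) →ₗ[ℂ] ⨂[ℂ] i, V (l i))
    (hT : ∀ σ, omega V l σ * T = T * omega V l σ) :
    ∃ f : (Fin n → Γ) → ℂ, integrate (extTensor p l) f = T ∧
      ∀ (σ : Equiv.Perm (Fin n)) γ, f (mulAutArrow σ γ) = f γ := by
  classical
  obtain ⟨f, hf, hf0⟩ := exists_integrate_extTensor_eq p hirr hne l T
  have hc : (Fintype.card (stab l) : ℂ) ≠ 0 := Nat.cast_ne_zero.2 Fintype.card_ne_zero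
  -- The sum is over all of `S_n`, but only the permutations in `S_π` contribute, each giving `T`;
  -- hence the factor `|S_π|⁻¹`.
  refine ⟨fun γ => (Fintype.card (stab l) : ℂ)⁻¹ *
    ∑ σ : Equiv.Perm (Fin n), f (mulAutArrow σ γ), ?_, fun τ γ => ?_⟩
  · have h1 : ∀ σ : Equiv.Perm (Fin n),
        integrate (extTensor p l) (fun γ => f (mulAutArrow σ γ)) =
          if σ ∈ stab l then T else 0 := by
      intro σ
      split_ifs with hσ
      · have h := congrArg (· * omega V l ⟨σ, hσ⟩) (integrate_comp_mulAutArrow p l ⟨σ, hσ⟩ f)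
        simp only [hf, hT] at h
        rwa [mul_assoc, mul_assoc, ← map_mul, inv_mul_cancel, map_one, mul_one, mul_one] at h
      · exact hf0 σ hσ
    have h2 : integrate (extTensor p l) (fun γ => (Fintype.card (stab l) : ℂ)⁻¹ *
        ∑ σ : Equiv.Perm (Fin n), f (mulAutArrow σ γ)) = (Fintype.card (stab l) : ℂ)⁻¹ •
        ∑ σ : Equiv.Perm (Fin n), integrate (extTensor p l) fun γ => f (mulAutArrow σ γ) := by
      simp only [integrate, mul_smul, Finset.sum_smul, ← Finset.smul_sum]
      rw [Finset.sum_comm]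
    rw [h2, Finset.sum_congr rfl fun σ _ => h1 σ, ← Finset.sum_filter, Finset.sum_const,
      ← Nat.cast_smul_eq_nsmul ℂ, ← Fintype.card_subtype, smul_smul]
    exact (congrArg (· • T) (inv_mul_cancel₀ hc)).trans (one_smul _ _)
  · refine congrArg _ ?_
    refine Fintype.sum_equiv (Equiv.mulRight τ) _ _ fun σ => ?_
    rw [Equiv.coe_mulRight, map_mul]
    rfl

end Biinvariant

/-! ### The action of `S_π` on the diagonal invariants -/

section DiagonalInvariants

open Representation

variable {Γ : Type*} [Group Γ] {S : Type*} {V : S → Type*} [∀ s, AddCommGroup (V s)]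
  [∀ s, Module ℂ (V s)] {n : ℕ}

/-- The restriction of `π` to the diagonal subgroup. -/
def diagRep (p : ∀ s, Representation ℂ Γ (V s)) (l : Fin n → S) :
    Representation ℂ (diagonal Γ n) (⨂[ℂ] i, V (l i)) :=
  (extTensor p l).comp (diagonal Γ n).subtype

theorem omega_diagRep (p : ∀ s, Representation ℂ Γ (V s)) (l : Fin n → S) (σ : stab l)
    (δ : diagonal Γ n) : omega V l σ * diagRep p l δ = diagRep p l δ * omega V l σ :=
  (omega_extTensor p l σ δ).trans
    (congrArg (extTensor p l · * omega V l σ)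
      (mulAutArrow_of_mem_diagonal δ.2 (σ : Equiv.Perm (Fin n))))

/-- The action of `S_π` on the vectors of `π` that are invariant under the diagonal. -/
def invariantsRep (p : ∀ s, Representation ℂ Γ (V s)) (l : Fin n → S) :
    Representation ℂ (stab l) (diagRep p l).invariants where
  toFun σ := (omega V l σ).restrict fun v hv δ => by
    rw [← Module.End.mul_apply, ← omega_diagRep, Module.End.mul_apply, hv δ]
  map_one' := by ext; simp
  map_mul' a b := by ext; simp only [map_mul]; rfl

theorem coe_invariantsRep_apply (p : ∀ s, Representation ℂ Γ (V s)) (l : Fin n → S) (σ : stab l)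
    (w : (diagRep p l).invariants) : (invariantsRep p l σ w : ⨂[ℂ] i, V (l i)) = omega V l σ w :=
  rfl

variable [Finite Γ]

/-- The projection onto the vectors of `π` that are invariant under the diagonal. -/
def diagProj (p : ∀ s, Representation ℂ Γ (V s)) (l : Fin n → S) :
    (⨂[ℂ] i, V (l i)) →ₗ[ℂ] (diagRep p l).invariants :=
  LinearMap.codRestrict _ ((Nat.card (diagonal Γ n) : ℂ)⁻¹ • ∑ᶠ δ, diagRep p l δ) fun v δ => by
    have := Fintype.ofFinite (diagonal Γ n)
    simp only [finsum_eq_sum_of_fintype, LinearMap.smul_apply, LinearMap.sum_apply, map_smul,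
      map_sum]
    congr 1
    refine Fintype.sum_equiv (Equiv.mulLeft δ) _ _ fun a => ?_
    simp

theorem coe_diagProj [Fintype (diagonal Γ n)] (p : ∀ s, Representation ℂ Γ (V s)) (l : Fin n → S)
    (v : ⨂[ℂ] i, V (l i)) : (diagProj p l v : ⨂[ℂ] i, V (l i)) =
      (Nat.card (diagonal Γ n) : ℂ)⁻¹ • ∑ δ, diagRep p l δ v := by
  simp [diagProj, finsum_eq_sum_of_fintype]

theorem diagProj_coe (p : ∀ s, Representation ℂ Γ (V s)) (l : Fin n → S)
    (w : (diagRep p l).invariants) : diagProj p l w = w := by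
  have := Fintype.ofFinite (diagonal Γ n)
  ext
  rw [coe_diagProj, Finset.sum_congr rfl fun δ _ => w.2 δ, Finset.sum_const, Finset.card_univ,
    ← Nat.cast_smul_eq_nsmul ℂ, smul_smul, ← Nat.card_eq_fintype_card, inv_mul_cancel₀ (by simp),
    one_smul]

theorem diagProj_diagRep (p : ∀ s, Representation ℂ Γ (V s)) (l : Fin n → S) (δ : diagonal Γ n)
    (v : ⨂[ℂ] i, V (l i)) : diagProj p l (diagRep p l δ v) = diagProj p l v := by
  have := Fintype.ofFinite (diagonal Γ n)
  ext
  rw [coe_diagProj, coe_diagProj]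
  congr 1
  refine Fintype.sum_equiv (Equiv.mulRight δ) _ _ fun a => ?_
  simp

theorem diagProj_omega (p : ∀ s, Representation ℂ Γ (V s)) (l : Fin n → S) (σ : stab l)
    (v : ⨂[ℂ] i, V (l i)) :
    diagProj p l (omega V l σ v) = invariantsRep p l σ (diagProj p l v) := by
  have := Fintype.ofFinite (diagonal Γ n)
  ext
  rw [coe_invariantsRep_apply, coe_diagProj, coe_diagProj, map_smul, map_sum]
  congr 1
  refine Finset.sum_congr rfl fun δ _ => ?_
  rw [← Module.End.mul_apply, ← omega_diagRep, Module.End.mul_apply]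

/-- `M_π(σ)` is the trace of `ω σ` followed by the averaging projection, and cyclicity moves this
trace to the invariants. -/
theorem Mpi_eq_character [∀ s, FiniteDimensional ℂ (V s)] (p : ∀ s, Representation ℂ Γ (V s))
    (l : Fin n → S) (σ : stab l) : Mpi p l σ = (invariantsRep p l).character σ := by
  have := Fintype.ofFinite (diagonal Γ n)
  have h : Mpi p l σ = LinearMap.trace ℂ _
      ((diagRep p l).invariants.subtype ∘ₗ (diagProj p l ∘ₗ omega V l σ)) := by
    rw [Mpi, finsum_eq_sum_of_fintype, ← smul_eq_mul]
    simp only [Representation.character]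
    rw [← map_sum, ← map_smul]
    congr 1
    ext1
    ext1 v
    simp only [LinearMap.compMultilinearMap_apply, LinearMap.comp_apply, Submodule.subtype_apply,
      coe_diagProj, LinearMap.smul_apply, LinearMap.sum_apply]
    rfl
  rw [h, LinearMap.trace_comp_comm', Representation.character]
  congr 1
  ext1 w
  simp [diagProj_omega, diagProj_coe]

/-- If `(G_n, K_n)` is a Gelfand pair, then `S_π` acts without multiplicities on the vectors of `π`
that are invariant under the diagonal. -/
theorem intertwiningMap_comm_of_isGelfandPair [∀ s, FiniteDimensional ℂ (V s)]
    (p : ∀ s, Representation ℂ Γ (V s)) (hirr : ∀ s, (p s).IsIrreducible)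
    (hne : ∀ s t, Nonempty ((p s).Equiv (p t)) → s = t) (l : Fin n → S)
    (hG : IsGelfandPair (wreathK Γ n))
    (A B : IntertwiningMap (invariantsRep p l) (invariantsRep p l)) : A.comp B = B.comp A := by
  have := Fintype.ofFinite Γ
  -- Extension by zero on the kernel of the projection. It respects products, and restricting to the
  -- invariants recovers `A`.
  let T : IntertwiningMap (invariantsRep p l) (invariantsRep p l) →
      ((⨂[ℂ] i, V (l i)) →ₗ[ℂ] ⨂[ℂ] i, V (l i)) := fun A =>
    (diagRep p l).invariants.subtype ∘ₗ A.toLinearMap ∘ₗ diagProj p l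
  have hT : ∀ A v, T A v = A (diagProj p l v) := fun _ _ => rfl
  have key : ∀ A, ∃ F : (Fin n → Γ) → ℂ, IsBiinvariant (diagonal Γ n) F ∧
      (∀ (σ : Equiv.Perm (Fin n)) γ, F (mulAutArrow σ γ) = F γ) ∧
      integrate (extTensor p l) F = T A := by
    intro A
    obtain ⟨f, hf, hs⟩ := exists_symmetric_integrate_eq p hirr hne l (T A) fun σ =>
      LinearMap.ext fun v => by
        rw [Module.End.mul_apply, Module.End.mul_apply, hT, hT, diagProj_omega, A.isIntertwining,
          coe_invariantsRep_apply]
    obtain ⟨F, h1, h2, h3⟩ := exists_isBiinvariant_integrate_eq (extTensor p l) f hs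
      (fun δ hδ => by
        rw [hf]
        exact LinearMap.ext fun v => (A (diagProj p l v)).2 ⟨δ, hδ⟩)
      (fun δ hδ => by
        rw [hf]
        refine LinearMap.ext fun v => ?_
        rw [Module.End.mul_apply, hT, hT]
        exact congrArg (fun w => (A w : ⨂[ℂ] i, V (l i))) (diagProj_diagRep p l ⟨δ, hδ⟩ v))
    exact ⟨F, h1, h2, h3.trans hf⟩
  obtain ⟨F, hF, hFs, hFA⟩ := key A
  obtain ⟨F', hF', hFs', hFB⟩ := key B
  have h := integrate_commute_of_isGelfandPair hG (extTensor p l) F F' hF hF' hFs hFs'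
  rw [hFA, hFB] at h
  refine DFunLike.ext _ _ fun w => Subtype.ext ?_
  have hw := LinearMap.congr_fun h (w : ⨂[ℂ] i, V (l i))
  simp only [Module.End.mul_apply, hT, diagProj_coe] at hw
  exact hw

end DiagonalInvariants

end WreathGelfand

end

/-! ### The main theorem -/

theorem lemma3p1 {Γ : Type*} [Group Γ] [Finite Γ] {S : Type*} {V : S → Type*}
    [∀ s, AddCommGroup (V s)] [∀ s, Module ℂ (V s)] [∀ s, FiniteDimensional ℂ (V s)]
    -- irreducible representations `π_s` of `Γ`, pairwise non-isomorphic
    (p : ∀ s, Representation ℂ Γ (V s)) (hirr : ∀ s, (p s).IsIrreducible)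
    (hne : ∀ s t, Nonempty ((p s).Equiv (p t)) → s = t)
    (n : ℕ) (l : Fin n → S)
    -- `M_π(e)` is a real number
    (hM : ((∑ ρ : WreathGelfand.Dual (WreathGelfand.stab l), ρ.dim : ℕ) : ℝ) <
      (WreathGelfand.Mpi p l 1).re) :
    -- `a` is the family of coefficients of `M_π` with respect to the irreducible characters
    (∃ a : WreathGelfand.Dual (WreathGelfand.stab l) → ℕ,
      (∀ σ, WreathGelfand.Mpi p l σ = ∑ ρ, (a ρ : ℂ) * ρ.character σ) ∧
      (∀ b : WreathGelfand.Dual (WreathGelfand.stab l) → ℂ,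
        (∀ σ, WreathGelfand.Mpi p l σ = ∑ ρ, b ρ * ρ.character σ) → ∀ ρ, b ρ = a ρ) ∧
      ∃ ρ, 2 ≤ a ρ) ∧
    ¬ WreathGelfand.IsGelfandPair (WreathGelfand.wreathK Γ n) := by
  open WreathGelfand in
  obtain ⟨a, ha, hnc⟩ := exists_multiplicity (invariantsRep p l)
  have hMa : ∀ σ, Mpi p l σ = ∑ ρ, (a ρ : ℂ) * ρ.character σ := fun σ =>
    (Mpi_eq_character p l σ).trans (ha σ)
  have h2 : ∃ ρ, 2 ≤ a ρ := by
    -- If every `a ρ ≤ 1`, then `M_π(e) = ∑ a ρ * dim ρ` is at most `∑ dim ρ`.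
    by_contra! h
    have h1 : Mpi p l 1 = ((∑ ρ, a ρ * ρ.dim : ℕ) : ℂ) := by
      rw [hMa]
      simp [Dual.character_one]
    rw [h1, Complex.natCast_re, Nat.cast_lt] at hM
    refine hM.not_ge (Finset.sum_le_sum fun ρ _ => ?_)
    exact (Nat.mul_le_mul_right _ (Nat.le_of_lt_succ (h ρ))).trans_eq (one_mul _)
  refine ⟨⟨a, hMa, fun b hb ρ => ?_, h2⟩, fun hG => ?_⟩
  · have hli := Fintype.linearIndependent_iff.1
      (Dual.linearIndependent_character (H := stab l)) (fun ρ => b ρ - a ρ) ?_ ρ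
    · exact sub_eq_zero.1 hli
    · funext σ
      simp [sub_mul, ← hb σ, ← hMa σ]
  · obtain ⟨ρ, hρ⟩ := h2
    obtain ⟨A, B, hAB⟩ := hnc ρ hρ
    exact hAB (intertwiningMap_comm_of_isGelfandPair p hirr hne l hG A B)
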